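/- Let $n\geqslant 1$ and let $X=(X_1,\dots,X_n)$ be a random vector in $\mathbb{R}^n$ that is isotropic, i.e. $\mathbb{E}\langle X,\theta\rangle=0$ and $\mathbb{E}\langle X,\theta\rangle^2=1$ for every unit vector $\theta$, and that has a radially symmetric density $f_X(x)=f_X(|x|)$ with respect to Lebesgue measure. Let $G=(G_1,\dots,G_n)$ be a standard Gaussian random vector in $\mathbb{R}^n$. For a real random variable $Y$ let \[ \Lambda_Y(t)=\log\mathbb{E}e^{tY}\in(-\infty,+\infty],\qquad \Lambda_Y^\ast(x)=\sup_{t\in\mathbb{R}}\bigl(xt-\Lambda_Y(t)\bigr)\in[0,+\infty]\qquad(t,x\in\mathbb{R}). \] Then $\Lambda_{G_1}(t)=t^2/2$ for every $t\in\mathbb{R}$, and the following hold. (i) If the function $r\mapsto f_X(\sqrt r)$ is log-concave on $(0,\infty)$, then $\Lambda_{X_1}(t)\leqslant\Lambda_{G_1}(t)$ for every $t\in\mathbb{R}$ and, as a consequence, $\Lambda_{X_1}^\ast(x)\geqslant\Lambda_{G_1}^\ast(x)$ for every $x\in\mathbb{R}$. (ii) If the function $r\mapsto f_X(\sqrt r)$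 is log-convex on $(0,\infty)$, then the reverse inequalities hold: $\Lambda_{X_1}(t)\geqslant\Lambda_{G_1}(t)$ for every $t\in\mathbb{R}$ and $\Lambda_{X_1}^\ast(x)\leqslant\Lambda_{G_1}^\ast(x)$ for every $x\in\mathbb{R}$. -/

import Mathlib

open MeasureTheory ProbabilityTheory

noncomputable section

/-- A nonnegative function `f` is log-concave on the convex set `s ⊆ ℝ`. The value `0` is allowed;
the exponents are positive, so that `log 0 = -∞` is read correctly. -/
def LogConcaveOn (s : Set ℝ) (f : ℝ → ℝ) : Prop :=
  Convex ℝ s ∧ (∀ x ∈ s, 0 ≤ f x) ∧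
    ∀ x ∈ s, ∀ y ∈ s, ∀ a b : ℝ, 0 < a → 0 < b → a + b = 1 →
      f x ^ a * f y ^ b ≤ f (a * x + b * y)

/-- A nonnegative function `f` is log-convex on the convex set `s ⊆ ℝ`. -/
def LogConvexOn (s : Set ℝ) (f : ℝ → ℝ) : Prop :=
  Convex ℝ s ∧ (∀ x ∈ s, 0 ≤ f x) ∧
    ∀ x ∈ s, ∀ y ∈ s, ∀ a b : ℝ, 0 < a → 0 < b → a + b = 1 →
      f (a * x + b * y) ≤ f x ^ a * f y ^ b

/-- The class of functions `f` on `(0, ∞)` such that `x ↦ f (√x)` is log-concave. -/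
def LCconc : Set (ℝ → ℝ) :=
  {f | LogConcaveOn (Set.Ioi 0) fun x => f (Real.sqrt x)}

/-- The class of functions `f` on `(0, ∞)` such that `x ↦ f (√x)` is log-convex. -/
def LCconv : Set (ℝ → ℝ) :=
  {f | LogConvexOn (Set.Ioi 0) fun x => f (Real.sqrt x)}

/-- The real function `r ↦ f (r e₁)` with which a radial function `f` on `ℝⁿ` is identified. -/
def radialProfile {n : ℕ} [NeZero n] (f : EuclideanSpace ℝ (Fin n) → ℝ) : ℝ → ℝ :=
  fun r => f (r • EuclideanSpace.single 0 1)

/-- The random vector `X` has the radially symmetric density `f` with respect to Lebesgue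
measure on `ℝⁿ`. -/
structure HasRadialDensity {Ω : Type*} [MeasurableSpace Ω] {n : ℕ}
    (X : Ω → EuclideanSpace ℝ (Fin n)) (P : Measure Ω)
    (f : EuclideanSpace ℝ (Fin n) → ℝ) : Prop where
  aemeasurable : AEMeasurable X P
  measurable_density : Measurable f
  nonneg : ∀ x, 0 ≤ f x
  radial : ∀ x y, ‖x‖ = ‖y‖ → f x = f y
  map_eq : P.map X = volume.withDensity fun x => ENNReal.ofReal (f x)

/-- The random vector `X` is isotropic: every marginal `⟨X, θ⟩`, `|θ| = 1`, has mean zero and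
second moment one. (The second condition forces `⟨X, θ⟩` to be square integrable.) -/
def IsIsotropic {Ω : Type*} [MeasurableSpace Ω] {n : ℕ}
    (X : Ω → EuclideanSpace ℝ (Fin n)) (P : Measure Ω) : Prop :=
  ∀ θ : EuclideanSpace ℝ (Fin n), ‖θ‖ = 1 →
    ∫ ω, inner ℝ (X ω) θ ∂P = 0 ∧ ∫ ω, (inner ℝ (X ω) θ) ^ 2 ∂P = 1

/-- The cumulant generating function `Λ_Y(t) = log 𝔼 exp(tY)` of a real random variable, with
value `+∞` where the expectation is infinite. -/
def cumulantGF {Ω : Type*} [MeasurableSpace Ω] (Y : Ω → ℝ) (P : Measure Ω) (t : ℝ) : EReal :=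
  ENNReal.log (∫⁻ ω, ENNReal.ofReal (Real.exp (t * Y ω)) ∂P)

/-- The Cramér transform `Λ*_Y(x) = sup_t (x t - Λ_Y(t))` of a real random variable, with values
in the extended reals. -/
def cramerTransform {Ω : Type*} [MeasurableSpace Ω] (Y : Ω → ℝ) (P : Measure Ω) (x : ℝ) : EReal :=
  ⨆ t : ℝ, (((x * t : ℝ) : EReal) - cumulantGF Y P t)

end

/-! By rotation invariance, the exponential moment of a marginal is the integral of `φ(|x|²)`, where
`φ(s)` averages `cosh (t √s ⟨u, e⟩)` over unit vectors `u`; this `φ` is convex in `s`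
(`lintegral_exp_inner_eq_sphericalCosh`, `convexOn_sphericalCosh`). Isotropy gives both densities
mass one and second moment `n`, so affine functions of `|x|²` have equal integrals against them. The
Gaussian density is log-affine in `s = |x|²`, so one density dominates the other on an interval of
`s`. Subtracting from `φ` its chord over this interval makes the sign of the remainder opposite to
that of the difference of densities; integration gives the inequality (`lintegral_radial_le`).
Cramér transforms follow by duality. -/

theorem convexOn_cosh_mul_sqrt (c : ℝ) :
    ConvexOn ℝ (Set.Ici 0) fun s => Real.cosh (c * √s) := by
  -- In the variable `s` this is a power series with nonnegative coefficients, so convexity is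
  -- checked termwise.
  have key : ∀ s : ℝ, 0 ≤ s →
      HasSum (fun k : ℕ => c ^ (2 * k) / ((2 * k).factorial : ℝ) * s ^ k)
        (Real.cosh (c * √s)) := by
    intro s hs
    convert! Real.hasSum_cosh (c * √s) using 2 with k
    rw [mul_pow, pow_mul √s, Real.sq_sqrt hs]
    ring
  refine ⟨convex_Ici 0, fun x hx y hy a b ha hb hab => ?_⟩
  have hxy := (convex_Ici (0 : ℝ)) hx hy ha hb hab
  refine hasSum_le (fun k => ?_) (key _ hxy) (((key x hx).mul_left a).add ((key y hy).mul_left b))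
  have hk := (convexOn_pow k).2 hx hy ha hb hab
  have hc : 0 ≤ c ^ (2 * k) / ((2 * k).factorial : ℝ) :=
    div_nonneg (Even.pow_nonneg (even_two_mul k) c) (by positivity)
  have := mul_le_mul_of_nonneg_left hk hc
  simp only [smul_eq_mul] at this ⊢
  linear_combination this

/-- The line is the secant through `α` and `β`. The end points are left out: in the application they
correspond to null spheres. -/
theorem ConvexOn.exists_chord {φ : ℝ → ℝ} {s : Set ℝ} (hφ : ConvexOn ℝ s φ) {α β : ℝ}
    (hα : α ∈ s) (hβ : β ∈ s) (hαβ : α < β) :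
    ∃ a b : ℝ, (∀ x ∈ Set.Ioo α β, φ x ≤ a + b * x) ∧
      ∀ x ∈ s, x < α ∨ β < x → a + b * x ≤ φ x := by
  set b := (φ β - φ α) / (β - α) with hb
  have hd : 0 < β - α := sub_pos.2 hαβ
  have hbd : b * (β - α) = φ β - φ α := div_mul_cancel₀ _ hd.ne'
  refine ⟨φ α - b * α, b, fun x hx => ?_, ?_⟩
  · have := hφ.secant_mono_aux1 hα hβ hx.1 hx.2
    have h2 : (β - α) * φ x ≤ (β - α) * (φ α - b * α + b * x) := by
      linear_combination this - (x - α) * hbd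
    exact le_of_mul_le_mul_left h2 hd
  · rintro x hxs (hx | hx)
    · have := hφ.secant_mono_aux1 hxs hβ hx hαβ
      have h2 : (β - α) * (φ α - b * α + b * x) ≤ (β - α) * φ x := by
        linear_combination this + (x - α) * hbd
      exact le_of_mul_le_mul_left h2 hd
    · have := hφ.secant_mono_aux1 hα hxs hαβ hx
      have h2 : (β - α) * (φ α - b * α + b * x) ≤ (β - α) * φ x := by
        linear_combination this + (x - α) * hbd
      exact le_of_mul_le_mul_left h2 hd

/-- Two densities with the same integral and the same moment of `q` are ordered on `Φ` if
`Φ - (a + b q)` and their difference have opposite signs. -/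
theorem lintegral_mul_le_of_sign {E : Type*} [MeasurableSpace E] {ν : Measure E}
    {f₁ f₂ q Φ : E → ℝ} (hf₁ : Integrable f₁ ν) (hf₂ : Integrable f₂ ν)
    (hq₁ : Integrable (fun x => q x * f₁ x) ν) (hq₂ : Integrable (fun x => q x * f₂ x) ν)
    (hm : ∫ x, f₁ x ∂ν = ∫ x, f₂ x ∂ν)
    (hmq : ∫ x, q x * f₁ x ∂ν = ∫ x, q x * f₂ x ∂ν)
    (h₁ : ∀ x, 0 ≤ f₁ x) (h₂ : ∀ x, 0 ≤ f₂ x) (hΦ : ∀ x, 0 ≤ Φ x)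
    (hΦm : AEStronglyMeasurable Φ ν) (a b : ℝ)
    (h : ∀ᵐ x ∂ν, (Φ x - (a + b * q x)) * (f₁ x - f₂ x) ≤ 0) :
    ∫⁻ x, ENNReal.ofReal (Φ x * f₁ x) ∂ν ≤ ∫⁻ x, ENNReal.ofReal (Φ x * f₂ x) ∂ν := by
  by_cases htop : ∫⁻ x, ENNReal.ofReal (Φ x * f₂ x) ∂ν = ⊤
  · simp [htop]
  have i₂ : Integrable (fun x => Φ x * f₂ x) ν := by
    refine ⟨hΦm.mul hf₂.1, ?_⟩
    rw [hasFiniteIntegral_iff_ofReal (.of_forall fun x => mul_nonneg (hΦ x) (h₂ x))]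
    exact lt_top_iff_ne_top.2 htop
  have iA : Integrable (fun x => a * (f₁ x - f₂ x)) ν := (hf₁.sub hf₂).const_mul a
  have iB : Integrable (fun x => b * (q x * f₁ x - q x * f₂ x)) ν := (hq₁.sub hq₂).const_mul b
  have iL : Integrable (fun x => Φ x * f₂ x + a * (f₁ x - f₂ x)) ν := i₂.add iA
  have iR : Integrable (fun x => Φ x * f₂ x + a * (f₁ x - f₂ x)
      + b * (q x * f₁ x - q x * f₂ x)) ν := iL.add iB
  -- This is the sign condition rearranged. It yields integrability of `Φ f₁`, and the two
  -- correction terms integrate to zero.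
  have hle : ∀ᵐ x ∂ν, Φ x * f₁ x ≤ Φ x * f₂ x + a * (f₁ x - f₂ x)
      + b * (q x * f₁ x - q x * f₂ x) := by
    filter_upwards [h] with x hx
    linear_combination hx
  have i₁ : Integrable (fun x => Φ x * f₁ x) ν := by
    refine iR.mono' (hΦm.mul hf₁.1) ?_
    filter_upwards [hle] with x hx
    rwa [Real.norm_of_nonneg (mul_nonneg (hΦ x) (h₁ x))]
  rw [← ofReal_integral_eq_lintegral_ofReal i₁ (.of_forall fun x => mul_nonneg (hΦ x) (h₁ x)),
    ← ofReal_integral_eq_lintegral_ofReal i₂ (.of_forall fun x => mul_nonneg (hΦ x) (h₂ x))]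
  apply ENNReal.ofReal_le_ofReal
  refine (integral_mono_ae i₁ iR hle).trans_eq ?_
  rw [integral_add iL iB, integral_add i₂ iA, integral_const_mul, integral_const_mul,
    integral_sub hf₁ hf₂, integral_sub hq₁ hq₂, hm, hmq]
  ring

/-! ### Comparison of radial densities -/

section Radial

variable {E : Type*} [NormedAddCommGroup E] [InnerProductSpace ℝ E] [FiniteDimensional ℝ E]
  [MeasurableSpace E] [BorelSpace E]

theorem ae_norm_sq_ne [Nontrivial E] (r : ℝ) : ∀ᵐ x : E, ‖x‖ ^ 2 ≠ r := by
  have := Measure.addHaar_sphere (volume : Measure E) 0 (√r)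
  refine measure_mono_null (fun x hx => ?_) this
  have hx' : ‖x‖ ^ 2 = r := by simpa using hx
  simp [← hx']

/-- Radial densities `F₁(|x|²)`, `F₂(|x|²)` with equal mass and second moment, the first of which
is the larger one exactly on a shell, are ordered on convex functions of `|x|²`. -/
theorem lintegral_radial_le [Nontrivial E] {F₁ F₂ φ : ℝ → ℝ} {f₁ f₂ : E → ℝ}
    (hF₁ : ∀ x, f₁ x = F₁ (‖x‖ ^ 2)) (hF₂ : ∀ x, f₂ x = F₂ (‖x‖ ^ 2))
    (hS : Convex ℝ {s | 0 < s ∧ F₂ s ≤ F₁ s})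
    (hf₁ : Integrable f₁) (hf₂ : Integrable f₂)
    (hq₁ : Integrable fun x => ‖x‖ ^ 2 * f₁ x) (hq₂ : Integrable fun x => ‖x‖ ^ 2 * f₂ x)
    (hm : ∫ x, f₁ x = ∫ x, f₂ x) (hmq : ∫ x, ‖x‖ ^ 2 * f₁ x = ∫ x, ‖x‖ ^ 2 * f₂ x)
    (h₁ : ∀ x, 0 ≤ f₁ x) (h₂ : ∀ x, 0 ≤ f₂ x)
    (hφ : ConvexOn ℝ (Set.Ici 0) φ) (hφ0 : ∀ s, 0 ≤ φ s)
    (hφm : AEStronglyMeasurable (fun x : E => φ (‖x‖ ^ 2)) volume) :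
    ∫⁻ x, ENNReal.ofReal (φ (‖x‖ ^ 2) * f₁ x) ≤ ∫⁻ x, ENNReal.ofReal (φ (‖x‖ ^ 2) * f₂ x) := by
  set S := {s | 0 < s ∧ F₂ s ≤ F₁ s} with hSdef
  have hSo : S.OrdConnected := hS.ordConnected
  have hbelow : BddBelow S := ⟨0, fun s hs => hs.1.le⟩
  have hpos : ∀ s ∈ S, 0 ≤ s := fun s hs => hs.1.le
  have hmem : ∀ x : E, ‖x‖ ^ 2 ∈ S → f₂ x ≤ f₁ x := fun x hx => by
    rw [hF₁, hF₂]; exact hx.2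
  have hnot : ∀ x : E, ‖x‖ ^ 2 ≠ 0 → ‖x‖ ^ 2 ∉ S → f₁ x ≤ f₂ x := fun x h0 hx => by
    rw [hF₁, hF₂]
    by_contra! hlt
    exact hx ⟨lt_of_le_of_ne (by positivity) h0.symm, hlt.le⟩
  have hlow : ∀ s, s < sInf S → s ∉ S := fun s hs hsS => (csInf_le hbelow hsS).not_gt hs
  -- Here `f₁ ≤ f₂` off a null set, so the zero line serves as chord.
  by_cases hsub : S.Subsingleton
  · refine lintegral_mul_le_of_sign hf₁ hf₂ hq₁ hq₂ hm hmq h₁ h₂ (fun x => hφ0 _) hφm 0 0 ?_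
    filter_upwards [ae_norm_sq_ne (E := E) 0, ae_norm_sq_ne (E := E) (sInf S)] with x h0 hx
    have : ‖x‖ ^ 2 ∉ S := by
      intro hxS
      rw [(Set.subsingleton_iff_singleton hxS).1 hsub, csInf_singleton] at hx
      exact hx rfl
    simpa using mul_nonpos_of_nonneg_of_nonpos (hφ0 _) (sub_nonpos.2 (hnot x h0 this))
  obtain ⟨s₀, hs₀, s₁, hs₁, hs₀₁⟩ := Set.not_subsingleton_iff.1 hsub |>.exists_lt
  have hne : S.Nonempty := ⟨s₀, hs₀⟩
  by_cases hab : BddAbove S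
  · have hup : ∀ s, sSup S < s → s ∉ S := fun s hs hsS => (le_csSup hab hsS).not_gt hs
    have hlt : sInf S < sSup S := (csInf_le hbelow hs₀).trans_lt (hs₀₁.trans_le (le_csSup hab hs₁))
    have hα : 0 ≤ sInf S := le_csInf hne hpos
    obtain ⟨a, b, hin, hout⟩ := hφ.exists_chord (Set.mem_Ici.2 hα)
      (Set.mem_Ici.2 (hα.trans hlt.le)) hlt
    refine lintegral_mul_le_of_sign hf₁ hf₂ hq₁ hq₂ hm hmq h₁ h₂ (fun x => hφ0 _) hφm a b ?_
    filter_upwards [ae_norm_sq_ne (E := E) 0, ae_norm_sq_ne (E := E) (sInf S),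
      ae_norm_sq_ne (E := E) (sSup S)] with x h0 hxα hxβ
    by_cases hxI : ‖x‖ ^ 2 ∈ Set.Ioo (sInf S) (sSup S)
    · obtain ⟨u, hu, hux⟩ := exists_lt_of_csInf_lt hne hxI.1
      obtain ⟨v, hv, hxv⟩ := exists_lt_of_lt_csSup hne hxI.2
      exact mul_nonpos_of_nonpos_of_nonneg (sub_nonpos.2 (hin _ hxI))
        (sub_nonneg.2 (hmem x (hSo.out hu hv ⟨hux.le, hxv.le⟩)))
    · have hx' : ‖x‖ ^ 2 < sInf S ∨ sSup S < ‖x‖ ^ 2 := by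
        by_contra! hcon
        exact hxI ⟨lt_of_le_of_ne hcon.1 hxα.symm, lt_of_le_of_ne hcon.2 hxβ⟩
      have hxS : ‖x‖ ^ 2 ∉ S := hx'.elim (hlow _) (hup _)
      exact mul_nonpos_of_nonneg_of_nonpos
        (sub_nonneg.2 (hout _ (Set.mem_Ici.2 (by positivity)) hx')) (sub_nonpos.2 (hnot x h0 hxS))
  -- With `S` unbounded, the only sign change is at `sInf S`. Then `(‖x‖² - sInf S) (f₁ - f₂)` is
  -- nonnegative with zero integral, so the densities agree almost everywhere.
  · have i₁ : Integrable fun x : E => ‖x‖ ^ 2 * f₁ x - ‖x‖ ^ 2 * f₂ x := hq₁.sub hq₂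
    have i₂ : Integrable fun x : E => sInf S * (f₁ x - f₂ x) := (hf₁.sub hf₂).const_mul _
    have hz : ∫ x : E, (‖x‖ ^ 2 * f₁ x - ‖x‖ ^ 2 * f₂ x) - sInf S * (f₁ x - f₂ x) = 0 := by
      rw [integral_sub i₁ i₂, integral_const_mul, integral_sub hf₁ hf₂, integral_sub hq₁ hq₂,
        hm, hmq]
      ring
    have hnn : 0 ≤ᵐ[volume] fun x : E =>
        (‖x‖ ^ 2 * f₁ x - ‖x‖ ^ 2 * f₂ x) - sInf S * (f₁ x - f₂ x) := by
      filter_upwards [ae_norm_sq_ne (E := E) 0, ae_norm_sq_ne (E := E) (sInf S)] with x h0 hxα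
      have heq : (‖x‖ ^ 2 * f₁ x - ‖x‖ ^ 2 * f₂ x) - sInf S * (f₁ x - f₂ x)
        = (‖x‖ ^ 2 - sInf S) * (f₁ x - f₂ x) := by ring
      simp only [Pi.zero_apply]
      rw [heq]
      rcases lt_or_gt_of_ne hxα with hx | hx
      · exact mul_nonneg_of_nonpos_of_nonpos (sub_nonpos.2 hx.le)
          (sub_nonpos.2 (hnot x h0 (hlow _ hx)))
      · obtain ⟨u, hu, hux⟩ := exists_lt_of_csInf_lt hne hx
        obtain ⟨v, hv, hxv⟩ := not_bddAbove_iff.1 hab (‖x‖ ^ 2)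
        exact mul_nonneg (sub_nonneg.2 hx.le)
          (sub_nonneg.2 (hmem x (hSo.out hu hv ⟨hux.le, hxv.le⟩)))
    have hae := (integral_eq_zero_iff_of_nonneg_ae hnn (i₁.sub i₂)).1 hz
    refine (lintegral_congr_ae ?_).le
    filter_upwards [hae, ae_norm_sq_ne (E := E) (sInf S)] with x hx hxα
    have hx' : (‖x‖ ^ 2 - sInf S) * (f₁ x - f₂ x) = 0 := by
      simp only [Pi.zero_apply] at hx
      linear_combination hx
    rw [sub_eq_zero.1 ((mul_eq_zero.1 hx').resolve_left (sub_ne_zero.2 hxα))]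

end Radial

/-! ### Gaussian density and second moments -/

section Gaussian

variable {E : Type*} [NormedAddCommGroup E] [InnerProductSpace ℝ E] [FiniteDimensional ℝ E]
  [MeasurableSpace E] [BorelSpace E]

theorem integrable_gaussianDensity (c : ℝ) :
    Integrable fun x : E => c * Real.exp (-‖x‖ ^ 2 / 2) := by
  refine Integrable.const_mul (Integrable.of_integral_ne_zero ?_) c
  have := GaussianFourier.integral_rexp_neg_mul_sq_norm (V := E) (b := 1 / 2) (by norm_num)
  have h2 : ∫ x : E, Real.exp (-‖x‖ ^ 2 / 2) =
      (Real.pi / (1 / 2)) ^ (Module.finrank ℝ E / 2 : ℝ) := by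
    rw [← this]; congr 1; ext x; ring_nf
  rw [h2]
  positivity

/-- The standard Gaussian measure has density `(2π)^(-n/2) exp (-|x|² / 2)`. -/
theorem stdGaussian_eq_withDensity :
    stdGaussian E = (volume : Measure E).withDensity fun x => ENNReal.ofReal
      ((2 * Real.pi) ^ (-(Module.finrank ℝ E / 2 : ℝ)) * Real.exp (-‖x‖ ^ 2 / 2)) := by
  set c := (2 * Real.pi) ^ (-(Module.finrank ℝ E / 2 : ℝ)) with hc
  have hc0 : 0 ≤ c := by positivity
  have : IsFiniteMeasure ((volume : Measure E).withDensity fun x => ENNReal.ofReal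
      (c * Real.exp (-‖x‖ ^ 2 / 2))) :=
    isFiniteMeasure_withDensity_ofReal (integrable_gaussianDensity c).2
  apply Measure.ext_of_charFun
  ext t
  rw [charFun_stdGaussian, charFun_apply, integral_withDensity_eq_integral_toReal_smul
    (by fun_prop) (.of_forall fun x => ENNReal.ofReal_lt_top)]
  have h1 : ∀ x : E, (ENNReal.ofReal (c * Real.exp (-‖x‖ ^ 2 / 2))).toReal •
      Complex.exp ((inner ℝ x t : ℝ) * Complex.I) =
      (c : ℂ) * Complex.exp (-(1 / 2 : ℂ) * ‖x‖ ^ 2 + Complex.I * (inner ℝ t x : ℝ)) := by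
    intro x
    rw [ENNReal.toReal_ofReal (by positivity), Complex.real_smul, Complex.exp_add,
      real_inner_comm]
    push_cast
    ring_nf
  simp_rw [h1]
  rw [integral_const_mul, GaussianFourier.integral_cexp_neg_mul_sq_norm_add (by norm_num)]
  have h2 : (Real.pi / (1 / 2 : ℂ)) ^ (Module.finrank ℝ E / 2 : ℂ) =
      (((2 * Real.pi) ^ (Module.finrank ℝ E / 2 : ℝ) : ℝ) : ℂ) := by
    rw [Complex.ofReal_cpow (by positivity)]
    push_cast
    congr 1
    ring
  rw [h2, ← mul_assoc, ← Complex.ofReal_mul, hc, Real.rpow_neg (by positivity),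
    inv_mul_cancel₀ (by positivity), Complex.ofReal_one, one_mul, Complex.I_sq]
  congr 1
  ring

theorem stdGaussian_singleton_zero [Nontrivial E] : stdGaussian E {0} = 0 := by
  rw [stdGaussian_eq_withDensity]
  exact withDensity_absolutelyContinuous _ _ (measure_singleton 0)

theorem integral_inner_sq_stdGaussian (θ : E) :
    ∫ x, (inner ℝ θ x) ^ 2 ∂stdGaussian E = ‖θ‖ ^ 2 := by
  have h := variance_dual_stdGaussian (innerSL ℝ θ)
  rw [variance_of_integral_eq_zero (by fun_prop) (integral_strongDual_stdGaussian _)] at h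
  simpa using h

omit [BorelSpace E] in
theorem integral_norm_sq_of_isotropic {μ : Measure E}
    (h : ∀ θ : E, ‖θ‖ = 1 → ∫ x, (inner ℝ θ x) ^ 2 ∂μ = 1) :
    Integrable (fun x => ‖x‖ ^ 2) μ ∧ ∫ x, ‖x‖ ^ 2 ∂μ = Module.finrank ℝ E := by
  let b := stdOrthonormalBasis ℝ E
  -- A nonzero integral forces integrability, as the Bochner integral defaults to `0`.
  have hi : ∀ i, Integrable (fun x => (inner ℝ (b i) x) ^ 2) μ := fun i =>
    .of_integral_ne_zero (by rw [h _ (b.norm_eq_one i)]; norm_num)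
  have hs : (fun x : E => ‖x‖ ^ 2) = fun x => ∑ i, (inner ℝ (b i) x) ^ 2 := by
    ext x; exact (b.sum_sq_inner_right x).symm
  rw [hs]
  refine ⟨integrable_finsetSum _ fun i _ => hi i, ?_⟩
  rw [integral_finsetSum _ fun i _ => hi i]
  simp [h _ (b.norm_eq_one _)]

end Gaussian

/-! ### Symmetrization over rotations -/

section Symmetrization

variable {E : Type*} [NormedAddCommGroup E] [InnerProductSpace ℝ E]

theorem exists_linearIsometryEquiv_apply_eq {v w : E} (h : ‖v‖ = ‖w‖) :
    ∃ U : E ≃ₗᵢ[ℝ] E, U v = w :=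
  ⟨_, Submodule.reflection_sub h⟩

variable [FiniteDimensional ℝ E] [MeasurableSpace E] [BorelSpace E]

/-- The average of `cosh ⟨t √s e, u⟩` over the unit vectors `u`, a Gaussian vector being used to
produce the uniformly distributed direction `u`. -/
noncomputable def sphericalCosh (e : E) (t s : ℝ) : ℝ :=
  ∫ y, Real.cosh (t * inner ℝ (‖y‖⁻¹ • y) e * √s) ∂stdGaussian E

theorem integrable_sphericalCosh (e : E) (t s : ℝ) :
    Integrable (fun y : E => Real.cosh (t * inner ℝ (‖y‖⁻¹ • y) e * √s)) (stdGaussian E) := by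
  refine Integrable.of_bound (C := Real.cosh (|t| * ‖e‖ * √s)) ?_ (.of_forall fun y => ?_)
  · exact Measurable.aestronglyMeasurable (by fun_prop)
  rw [Real.norm_of_nonneg (Real.cosh_pos _).le, Real.cosh_le_cosh, abs_mul, abs_mul, abs_mul,
    abs_mul, abs_abs, abs_norm]
  gcongr
  refine (abs_real_inner_le_norm _ _).trans ?_
  refine mul_le_of_le_one_left (norm_nonneg _) ?_
  rw [norm_smul, norm_inv, norm_norm]
  exact inv_mul_le_one

omit [BorelSpace E] in
theorem sphericalCosh_nonneg (e : E) (t s : ℝ) : 0 ≤ sphericalCosh e t s :=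
  integral_nonneg fun _ => (Real.cosh_pos _).le

theorem convexOn_sphericalCosh (e : E) (t : ℝ) :
    ConvexOn ℝ (Set.Ici 0) (sphericalCosh e t) := by
  refine ⟨convex_Ici 0, fun x hx y hy a b ha hb hab => ?_⟩
  simp only [sphericalCosh, smul_eq_mul]
  have ix := (integrable_sphericalCosh e t x).const_mul a
  have iy := (integrable_sphericalCosh e t y).const_mul b
  rw [← integral_const_mul, ← integral_const_mul, ← integral_add ix iy]
  refine integral_mono (integrable_sphericalCosh e t _) (ix.add iy) fun z => ?_
  exact (convexOn_cosh_mul_sqrt _).2 hx hy ha hb hab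

theorem measurable_sphericalCosh (e : E) (t : ℝ) : Measurable (sphericalCosh e t) := by
  have : StronglyMeasurable (Function.uncurry fun (s : ℝ) (y : E) =>
      Real.cosh (t * inner ℝ (‖y‖⁻¹ • y) e * √s)) :=
    Measurable.stronglyMeasurable (by unfold Function.uncurry; fun_prop)
  exact this.integral_prod_right.measurable

/-- An isometry carries `x` to `‖x‖ • e` and preserves the Gaussian law of `y`, so only the norm of
`x` matters. -/
theorem lintegral_cosh_inner_stdGaussian {e : E} (he : ‖e‖ = 1) (t : ℝ) (x : E) :
    ∫⁻ y, ENNReal.ofReal (Real.cosh (t * inner ℝ (‖y‖⁻¹ • y) x)) ∂stdGaussian E =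
      ENNReal.ofReal (sphericalCosh e t (‖x‖ ^ 2)) := by
  rw [sphericalCosh, ofReal_integral_eq_lintegral_ofReal (integrable_sphericalCosh e t _)
    (.of_forall fun _ => (Real.cosh_pos _).le)]
  obtain ⟨U, hU⟩ := exists_linearIsometryEquiv_apply_eq (v := x) (w := ‖x‖ • e)
    (by simp [norm_smul, he])
  conv_rhs => rw [← stdGaussian_map U]
  rw [lintegral_map (by fun_prop) U.continuous.measurable]
  refine lintegral_congr fun y => ?_
  rw [← U.inner_map_map (‖y‖⁻¹ • y) x, hU, map_smul, U.norm_map, inner_smul_right,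
    Real.sqrt_sq (norm_nonneg x)]
  ring_nf

/-- Invariance under `x ↦ -x` leaves the even part of `exp`. This is needed for convexity in `s`:
the odd powers of `√s` include `√s` itself, which is not convex. -/
theorem lintegral_exp_inner_eq_lintegral_cosh {μ : Measure E}
    (hμ : ∀ U : E ≃ₗᵢ[ℝ] E, μ.map U = μ) (t : ℝ) (e : E) :
    ∫⁻ x, ENNReal.ofReal (Real.exp (t * inner ℝ e x)) ∂μ =
      ∫⁻ x, ENNReal.ofReal (Real.cosh (t * inner ℝ e x)) ∂μ := by
  have hneg : ∫⁻ x, ENNReal.ofReal (Real.exp (-(t * inner ℝ e x))) ∂μ =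
      ∫⁻ x, ENNReal.ofReal (Real.exp (t * inner ℝ e x)) ∂μ := by
    conv_rhs => rw [← hμ (LinearIsometryEquiv.neg ℝ)]
    rw [lintegral_map (by fun_prop) (LinearIsometryEquiv.neg ℝ).continuous.measurable]
    simp
  have hcosh : ∀ z : ℝ, 2 * ENNReal.ofReal (Real.cosh z) =
      ENNReal.ofReal (Real.exp z) + ENNReal.ofReal (Real.exp (-z)) := by
    intro z
    rw [← ENNReal.ofReal_add (Real.exp_pos _).le (Real.exp_pos _).le, Real.cosh_eq,
      ← ENNReal.ofReal_ofNat, ← ENNReal.ofReal_mul (by norm_num)]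
    ring_nf
  have h2 : 2 * ∫⁻ x, ENNReal.ofReal (Real.cosh (t * inner ℝ e x)) ∂μ =
      2 * ∫⁻ x, ENNReal.ofReal (Real.exp (t * inner ℝ e x)) ∂μ := by
    rw [← lintegral_const_mul _ (by fun_prop)]
    simp_rw [hcosh]
    rw [lintegral_add_left (by fun_prop), hneg, two_mul]
  exact ((ENNReal.mul_right_inj two_ne_zero ENNReal.ofNat_ne_top).1 h2).symm

/-- Symmetrization of the exponential moment of a rotation invariant measure. -/
theorem lintegral_exp_inner_eq_sphericalCosh {μ : Measure E} [SFinite μ]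
    (hμ : ∀ U : E ≃ₗᵢ[ℝ] E, μ.map U = μ) (t : ℝ) {e : E} (he : ‖e‖ = 1) :
    ∫⁻ x, ENNReal.ofReal (Real.exp (t * inner ℝ e x)) ∂μ =
      ∫⁻ x, ENNReal.ofReal (sphericalCosh e t (‖x‖ ^ 2)) ∂μ := by
  have : Nontrivial E := ⟨e, 0, by rintro rfl; simp at he⟩
  rw [lintegral_exp_inner_eq_lintegral_cosh hμ]
  -- All unit directions give the same value, so `e` may be replaced by a random direction and
  -- Tonelli applied.
  have hunit : ∀ u : E, ‖u‖ = 1 → ∫⁻ x, ENNReal.ofReal (Real.cosh (t * inner ℝ u x)) ∂μ =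
      ∫⁻ x, ENNReal.ofReal (Real.cosh (t * inner ℝ e x)) ∂μ := by
    intro u hu
    obtain ⟨U, hU⟩ := exists_linearIsometryEquiv_apply_eq (hu.trans he.symm)
    conv_rhs => rw [← hμ U]
    rw [lintegral_map (by fun_prop) U.continuous.measurable]
    refine lintegral_congr fun x => ?_
    rw [← hU, U.inner_map_map]
  simp_rw [← lintegral_cosh_inner_stdGaussian he]
  rw [lintegral_lintegral_swap (by unfold Function.uncurry; fun_prop)]
  have hae : ∀ᵐ y ∂stdGaussian E,
      ∫⁻ x, ENNReal.ofReal (Real.cosh (t * inner ℝ (‖y‖⁻¹ • y) x)) ∂μ =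
        ∫⁻ x, ENNReal.ofReal (Real.cosh (t * inner ℝ e x)) ∂μ := by
    have h0 : ∀ᵐ y ∂stdGaussian E, y ≠ 0 := by
      rw [ae_iff]; simpa using stdGaussian_singleton_zero (E := E)
    filter_upwards [h0] with y hy
    refine hunit _ ?_
    rw [norm_smul, norm_inv, norm_norm, inv_mul_cancel₀ (norm_ne_zero_iff.2 hy)]
  rw [lintegral_congr_ae hae, lintegral_const, measure_univ, mul_one]

theorem map_withDensity_of_radial {f : E → ℝ} (hf : Measurable f)
    (hr : ∀ x y, ‖x‖ = ‖y‖ → f x = f y) (U : E ≃ₗᵢ[ℝ] E) :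
    ((volume : Measure E).withDensity fun x => ENNReal.ofReal (f x)).map U =
      volume.withDensity fun x => ENNReal.ofReal (f x) := by
  ext s hs
  have hU : Measurable U := U.continuous.measurable
  rw [Measure.map_apply hU hs, withDensity_apply _ (hU hs), withDensity_apply _ hs,
    ← U.measurePreserving.setLIntegral_comp_preimage hs (by fun_prop)]
  refine lintegral_congr fun x => ?_
  rw [hr (U x) x (U.norm_map x)]

end Symmetrization

/-! ### From measures to densities -/

theorem integrable_of_isProbabilityMeasure_withDensity {E : Type*} [MeasurableSpace E]
    {ν : Measure E} {f : E → ℝ}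
    (hf : Measurable f) (h0 : ∀ x, 0 ≤ f x)
    [hp : IsProbabilityMeasure (ν.withDensity fun x => ENNReal.ofReal (f x))] :
    Integrable f ν ∧ ∫ x, f x ∂ν = 1 := by
  have h1 : ∫⁻ x, ENNReal.ofReal (f x) ∂ν = 1 := by
    rw [← setLIntegral_univ, ← withDensity_apply _ MeasurableSet.univ, measure_univ]
  have hi : Integrable f ν := by
    refine ⟨hf.aestronglyMeasurable, ?_⟩
    rw [hasFiniteIntegral_iff_ofReal (.of_forall h0), h1]
    exact ENNReal.one_lt_top
  refine ⟨hi, ?_⟩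
  rw [integral_eq_lintegral_of_nonneg_ae (.of_forall h0) hf.aestronglyMeasurable, h1,
    ENNReal.toReal_one]

theorem integrable_norm_sq_mul_of_withDensity {E : Type*} [NormedAddCommGroup E]
    [MeasurableSpace E] [OpensMeasurableSpace E] {ν : Measure E} {f : E → ℝ}
    (hf : Measurable f) (h0 : ∀ x, 0 ≤ f x)
    (h : Integrable (fun x => ‖x‖ ^ 2) (ν.withDensity fun x => ENNReal.ofReal (f x))) :
    Integrable (fun x => ‖x‖ ^ 2 * f x) ν ∧ ∫ x, ‖x‖ ^ 2 * f x ∂ν =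
      ∫ x, ‖x‖ ^ 2 ∂ν.withDensity fun x => ENNReal.ofReal (f x) := by
  have hlt : ∀ᵐ x ∂ν, ENNReal.ofReal (f x) < ⊤ := .of_forall fun x => ENNReal.ofReal_lt_top
  have heq : ∀ x : E, (ENNReal.ofReal (f x)).toReal * ‖x‖ ^ 2 = ‖x‖ ^ 2 * f x := fun x => by
    rw [ENNReal.toReal_ofReal (h0 x), mul_comm]
  constructor
  · rw [integrable_withDensity_iff_integrable_smul' (by fun_prop) hlt] at h
    simpa only [smul_eq_mul, heq] using h
  · rw [integral_withDensity_eq_integral_toReal_smul (by fun_prop) hlt]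
    simp only [smul_eq_mul, heq]

/-! ### Comparison of exponential moments -/

section Comparison

variable {E : Type*} [NormedAddCommGroup E] [InnerProductSpace ℝ E] [FiniteDimensional ℝ E]
  [MeasurableSpace E] [BorelSpace E]

/-- Isotropic radial densities `F₁(|x|²)`, `F₂(|x|²)`, the first of which is the larger one exactly
on a shell, have ordered exponential moments. -/
theorem lintegral_exp_inner_le_of_radial {F₁ F₂ : ℝ → ℝ} {f₁ f₂ : E → ℝ} {μ₁ μ₂ : Measure E}
    [IsProbabilityMeasure μ₁] [IsProbabilityMeasure μ₂]
    (hμ₁ : μ₁ = volume.withDensity fun x => ENNReal.ofReal (f₁ x))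
    (hμ₂ : μ₂ = volume.withDensity fun x => ENNReal.ofReal (f₂ x))
    (hF₁ : ∀ x, f₁ x = F₁ (‖x‖ ^ 2)) (hF₂ : ∀ x, f₂ x = F₂ (‖x‖ ^ 2))
    (hf₁ : Measurable f₁) (hf₂ : Measurable f₂) (h₁ : ∀ x, 0 ≤ f₁ x) (h₂ : ∀ x, 0 ≤ f₂ x)
    (hi₁ : ∀ θ : E, ‖θ‖ = 1 → ∫ x, (inner ℝ θ x) ^ 2 ∂μ₁ = 1)
    (hi₂ : ∀ θ : E, ‖θ‖ = 1 → ∫ x, (inner ℝ θ x) ^ 2 ∂μ₂ = 1)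
    (hS : Convex ℝ {s | 0 < s ∧ F₂ s ≤ F₁ s}) (t : ℝ) {e : E} (he : ‖e‖ = 1) :
    ∫⁻ x, ENNReal.ofReal (Real.exp (t * inner ℝ e x)) ∂μ₁ ≤
      ∫⁻ x, ENNReal.ofReal (Real.exp (t * inner ℝ e x)) ∂μ₂ := by
  have : Nontrivial E := ⟨e, 0, by rintro rfl; simp at he⟩
  have r₁ : ∀ U : E ≃ₗᵢ[ℝ] E, μ₁.map U = μ₁ := fun U => by
    rw [hμ₁]; exact map_withDensity_of_radial hf₁ (fun x y h => by rw [hF₁, hF₁, h]) U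
  have r₂ : ∀ U : E ≃ₗᵢ[ℝ] E, μ₂.map U = μ₂ := fun U => by
    rw [hμ₂]; exact map_withDensity_of_radial hf₂ (fun x y h => by rw [hF₂, hF₂, h]) U
  rw [lintegral_exp_inner_eq_sphericalCosh r₁ t he, lintegral_exp_inner_eq_sphericalCosh r₂ t he]
  obtain ⟨j₁, q₁⟩ := integral_norm_sq_of_isotropic hi₁
  obtain ⟨j₂, q₂⟩ := integral_norm_sq_of_isotropic hi₂
  have hφm := measurable_sphericalCosh e t
  subst hμ₁ hμ₂
  obtain ⟨a₁, b₁⟩ := integrable_of_isProbabilityMeasure_withDensity (ν := volume) hf₁ h₁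
  obtain ⟨a₂, b₂⟩ := integrable_of_isProbabilityMeasure_withDensity (ν := volume) hf₂ h₂
  obtain ⟨c₁, d₁⟩ := integrable_norm_sq_mul_of_withDensity hf₁ h₁ j₁
  obtain ⟨c₂, d₂⟩ := integrable_norm_sq_mul_of_withDensity hf₂ h₂ j₂
  have key := lintegral_radial_le hF₁ hF₂ hS a₁ a₂ c₁ c₂ (b₁.trans b₂.symm)
    (d₁.trans (q₁.trans (q₂.symm.trans d₂.symm))) h₁ h₂ (convexOn_sphericalCosh e t)
    (sphericalCosh_nonneg e t) (Measurable.aestronglyMeasurable (by fun_prop))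
  rw [lintegral_withDensity_eq_lintegral_mul _ (by fun_prop) (by fun_prop),
    lintegral_withDensity_eq_lintegral_mul _ (by fun_prop) (by fun_prop)]
  simpa only [Pi.mul_apply, mul_comm (ENNReal.ofReal (f₁ _)), mul_comm (ENNReal.ofReal (f₂ _)),
    ← ENNReal.ofReal_mul (sphericalCosh_nonneg e t _)] using key

end Comparison

/-! ### Gaussian transforms and crossing sets -/

theorem lintegral_exp_gaussianReal (t : ℝ) :
    ∫⁻ x, ENNReal.ofReal (Real.exp (t * x)) ∂gaussianReal 0 1 =
      ENNReal.ofReal (Real.exp (t ^ 2 / 2)) := by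
  have h := congrFun (mgf_id_gaussianReal (μ := 0) (v := 1)) t
  rw [← ofReal_integral_eq_lintegral_ofReal (integrable_exp_mul_gaussianReal t)
    (.of_forall fun _ => (Real.exp_pos _).le)]
  simpa [mgf] using congrArg ENNReal.ofReal h

theorem lintegral_exp_inner_stdGaussian {E : Type*} [NormedAddCommGroup E]
    [InnerProductSpace ℝ E] [FiniteDimensional ℝ E] [MeasurableSpace E] [BorelSpace E]
    {e : E} (he : ‖e‖ = 1) (t : ℝ) :
    ∫⁻ x, ENNReal.ofReal (Real.exp (t * inner ℝ e x)) ∂stdGaussian E =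
      ENNReal.ofReal (Real.exp (t ^ 2 / 2)) := by
  have hmap : (stdGaussian E).map (innerSL ℝ e) = gaussianReal 0 1 := by
    rw [IsGaussian.map_eq_gaussianReal, integral_strongDual_stdGaussian,
      variance_dual_stdGaussian]
    simp [he]
  rw [← lintegral_exp_gaussianReal, ← hmap, lintegral_map (by fun_prop) (by fun_prop)]
  simp

/-- Log-affinity of the Gaussian profile: equality holds in the log-concavity inequality, which
makes both crossing sets below convex. -/
theorem exp_neg_half_combo {c : ℝ} (hc : 0 < c) (x y : ℝ) {a b : ℝ} (hab : a + b = 1) :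
    (c * Real.exp (-x / 2)) ^ a * (c * Real.exp (-y / 2)) ^ b =
      c * Real.exp (-(a * x + b * y) / 2) := by
  rw [Real.mul_rpow hc.le (Real.exp_pos _).le, Real.mul_rpow hc.le (Real.exp_pos _).le,
    ← Real.exp_mul, ← Real.exp_mul, mul_mul_mul_comm, ← Real.rpow_add hc, hab, Real.rpow_one,
    ← Real.exp_add]
  ring_nf

theorem convex_setOf_gaussian_le {F : ℝ → ℝ} (hF : LogConcaveOn (Set.Ioi 0) F) {c : ℝ}
    (hc : 0 < c) : Convex ℝ {s | 0 < s ∧ c * Real.exp (-s / 2) ≤ F s} := by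
  refine convex_iff_forall_pos.2 fun x hx y hy a b ha hb hab => ?_
  refine ⟨hF.1 hx.1 hy.1 ha.le hb.le hab, ?_⟩
  simp only [smul_eq_mul]
  rw [← exp_neg_half_combo hc x y hab]
  refine le_trans ?_ (hF.2.2 x hx.1 y hy.1 a b ha hb hab)
  have h1 := hx.2
  have h2 := hy.2
  have h3 := hF.2.1 x hx.1
  gcongr

theorem convex_setOf_le_gaussian {F : ℝ → ℝ} (hF : LogConvexOn (Set.Ioi 0) F) {c : ℝ}
    (hc : 0 < c) : Convex ℝ {s | 0 < s ∧ F s ≤ c * Real.exp (-s / 2)} := by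
  refine convex_iff_forall_pos.2 fun x hx y hy a b ha hb hab => ?_
  refine ⟨hF.1 hx.1 hy.1 ha.le hb.le hab, ?_⟩
  simp only [smul_eq_mul]
  rw [← exp_neg_half_combo hc x y hab]
  refine (hF.2.2 x hx.1 y hy.1 a b ha hb hab).trans ?_
  have h1 := hx.2
  have h2 := hy.2
  have h3 := hF.2.1 x hx.1
  have h4 := hF.2.1 y hy.1
  gcongr

theorem cramerTransform_le_of_cumulantGF_le {Ω Ω' : Type*} [MeasurableSpace Ω]
    [MeasurableSpace Ω'] {P : Measure Ω} {P' : Measure Ω'} {Y : Ω → ℝ} {Z : Ω' → ℝ}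
    (h : ∀ t, cumulantGF Y P t ≤ cumulantGF Z P' t) (x : ℝ) :
    cramerTransform Z P' x ≤ cramerTransform Y P x :=
  iSup_mono fun t => EReal.sub_le_sub le_rfl (h t)

theorem cumulantGF_coord_eq {Ω : Type*} [MeasurableSpace Ω] {P : Measure Ω} {n : ℕ} [NeZero n]
    {X : Ω → EuclideanSpace ℝ (Fin n)} (hX : AEMeasurable X P) (t : ℝ) :
    cumulantGF (fun ω => X ω 0) P t = ENNReal.log (∫⁻ x, ENNReal.ofReal
      (Real.exp (t * inner ℝ (EuclideanSpace.single (0 : Fin n) (1 : ℝ)) x)) ∂P.map X) := by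
  rw [cumulantGF, lintegral_map' (by fun_prop) hX]
  simp [EuclideanSpace.inner_single_left]

theorem theorem3 {Ω Ω' : Type*} [MeasurableSpace Ω] [MeasurableSpace Ω']
    (P : Measure Ω) [IsProbabilityMeasure P] (P' : Measure Ω') [IsProbabilityMeasure P']
    (n : ℕ) [NeZero n]
    (X : Ω → EuclideanSpace ℝ (Fin n)) (f : EuclideanSpace ℝ (Fin n) → ℝ)
    (hXf : HasRadialDensity X P f) (hX : IsIsotropic X P)
    (G : Ω' → EuclideanSpace ℝ (Fin n))
    (hG : HasLaw G (stdGaussian (EuclideanSpace ℝ (Fin n))) P') :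
    (∀ t : ℝ, cumulantGF (fun ω => G ω 0) P' t = ((t ^ 2 / 2 : ℝ) : EReal)) ∧
    (radialProfile f ∈ LCconc →
      (∀ t : ℝ, cumulantGF (fun ω => X ω 0) P t ≤ cumulantGF (fun ω => G ω 0) P' t) ∧
      (∀ x : ℝ, cramerTransform (fun ω => G ω 0) P' x ≤ cramerTransform (fun ω => X ω 0) P x)) ∧
    (radialProfile f ∈ LCconv →
      (∀ t : ℝ, cumulantGF (fun ω => G ω 0) P' t ≤ cumulantGF (fun ω => X ω 0) P t) ∧
      (∀ x : ℝ, cramerTransform (fun ω => X ω 0) P x ≤ cramerTransform (fun ω => G ω 0) P' x)) := by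
  set e : EuclideanSpace ℝ (Fin n) := EuclideanSpace.single (0 : Fin n) (1 : ℝ) with he_def
  have he : ‖e‖ = 1 := by simp [he_def]
  obtain ⟨hXm, hfm, hf0, hfr, hmap⟩ := hXf
  have : IsProbabilityMeasure (P.map X) := Measure.isProbabilityMeasure_map hXm
  set c : ℝ := (2 * Real.pi) ^
    (-(Module.finrank ℝ (EuclideanSpace ℝ (Fin n)) / 2 : ℝ)) with hc_def
  have hc : 0 < c := by positivity
  have hprof : ∀ x, f x = radialProfile f (√(‖x‖ ^ 2)) := fun x =>
    hfr _ _ (by rw [Real.sqrt_sq (norm_nonneg x), norm_smul, he]; simp)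
  have hiX : ∀ θ : EuclideanSpace ℝ (Fin n), ‖θ‖ = 1 →
      ∫ x, (inner ℝ θ x) ^ 2 ∂P.map X = 1 := fun θ hθ => by
    rw [integral_map hXm (Measurable.aestronglyMeasurable (by fun_prop)), ← (hX θ hθ).2]
    simp_rw [real_inner_comm]
  have hiG : ∀ θ : EuclideanSpace ℝ (Fin n), ‖θ‖ = 1 →
      ∫ x, (inner ℝ θ x) ^ 2 ∂stdGaussian (EuclideanSpace ℝ (Fin n)) = 1 := fun θ hθ => by
    rw [integral_inner_sq_stdGaussian, hθ, one_pow]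
  have hGm : Measurable fun x : EuclideanSpace ℝ (Fin n) => c * Real.exp (-‖x‖ ^ 2 / 2) := by
    fun_prop
  have hG0 : ∀ x : EuclideanSpace ℝ (Fin n), 0 ≤ c * Real.exp (-‖x‖ ^ 2 / 2) := fun x => by
    positivity
  have hXexp := fun t => cumulantGF_coord_eq hXm t
  have hGexp := fun t => cumulantGF_coord_eq hG.aemeasurable t
  simp only [hG.map_eq] at hGexp
  refine ⟨fun t => ?_, fun hconc => ?_, fun hconv => ?_⟩
  · rw [hGexp, lintegral_exp_inner_stdGaussian he, ENNReal.log_ofReal_of_pos (Real.exp_pos _),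
      Real.log_exp]
  · have hle : ∀ t, cumulantGF (fun ω => X ω 0) P t ≤ cumulantGF (fun ω => G ω 0) P' t := by
      intro t
      rw [hXexp, hGexp]
      exact ENNReal.log_monotone (lintegral_exp_inner_le_of_radial hmap stdGaussian_eq_withDensity
        (F₁ := fun s => radialProfile f √s) (F₂ := fun s => c * Real.exp (-s / 2))
        hprof (fun _ => rfl) hfm hGm hf0 hG0 hiX hiG (convex_setOf_gaussian_le hconc hc) t he)
    exact ⟨hle, cramerTransform_le_of_cumulantGF_le hle⟩
  · have hle : ∀ t, cumulantGF (fun ω => G ω 0) P' t ≤ cumulantGF (fun ω => X ω 0) P t := by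
      intro t
      rw [hXexp, hGexp]
      -- The roles are exchanged: the Gaussian is now the density that dominates on the shell.
      exact ENNReal.log_monotone (lintegral_exp_inner_le_of_radial stdGaussian_eq_withDensity hmap
        (F₁ := fun s => c * Real.exp (-s / 2)) (F₂ := fun s => radialProfile f √s)
        (fun _ => rfl) hprof hGm hfm hG0 hf0 hiG hiX (convex_setOf_le_gaussian hconv hc) t he)
    exact ⟨hle, cramerTransform_le_of_cumulantGF_le hle⟩
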